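/- **Setting.** Let $R>0$ and let $\Gamma_0\subset\mathbb R^2$ be a non-selfintersecting regular $C^2$ curve (the image of an injective $C^2$ map $\gamma:\mathbb R\to\mathbb R^2$ with $\gamma'\neq 0$) which coincides with the line $x_2=0$ in $\{|x_1|>R\}$. Let $\Omega$ be the domain above $\Gamma_0$, i.e. the connected component of $\mathbb R^2\setminus\Gamma_0$ containing $(0,y)$ for all large $y$. For $r>0$ put $B_r^+=\{x\in\Omega:|x|<r\}$, let $D\subset B_R^+$ be open (the obstacle, possibly empty; no regularity or connectedness is needed), let $\rho>R$, and put $\Omega_R^+=B_R^+\setminus\overline D$ and $\Omega_\rho^+=B_\rho^+\setminus\overline D$. Functions are complex valued. Let $T>0$. Let the source $f\in H^1(0,T;L^2(\Omega_\rho^+))$ satisfy $f|_{t=0}=0$ and vanish outside a fixed compact subset of $\Omega_R^+$ for all $t\in[0,T]$. For radial medium functions $\sigma=\sigma(|x|)$, $\hat\sigma=\hat\sigma(|x|)$ the truncated PML problem is $$\partial_t u+(\sigma+\hat\sigma)u+\sigma u^*+\nabla\cdot p=f,\qquad \partial_t p^*=-\nabla u,\qquad \partial_t u^*=\sigma u,\qquad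 \partial_t p+\Lambda_1p=\partial_t p^*+\Lambda_2p^*$$ in $\Omega_\rho^+\times(0,T)$, with $u=0$ on $\partial\Omega_\rho^+\times(0,T)$ and $u=0$, $p=0$, $u^*=0$, $p^*=0$ at $t=0$. Here $\Lambda_1=M^{T}\mathrm{diag}\{\sigma,\hat\sigma\}M$, $\Lambda_2=M^{T}\mathrm{diag}\{\hat\sigma,\sigma\}M$ and $M=\begin{pmatrix}\cos\theta&\sin\theta\\-\sin\theta&\cos\theta\end{pmatrix}$ with $\theta$ the polar angle of $x$. A solution is a quadruple with $$u\in L^2(0,T;H^1_0(\Omega_\rho^+))\cap H^1(0,T;L^2(\Omega_\rho^+)),\qquad p\in L^2(0,T;H(\mathrm{div},\Omega_\rho^+))\cap H^1(0,T;L^2(\Omega_\rho^+)^2),$$ $$u^*\in H^1(0,T;L^2(\Omega_\rho^+)),\qquad p^*\in H^1(0,T;L^2(\Omega_\rho^+)^2),$$ which satisfies the equations almost everywhere (with weak derivatives); the boundary condition is expressed by $u(\cdot,t)\in H^1_0(\Omega_\rho^+)$. **Theorem.** There is a constant $C>0$, depending at most on $\Gamma_0,D,R,\rho$ (in particular independent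 of $\sigma$, $T$ and $f$), such that the following holds. Let $\sigma$ satisfy $\sigma(r)=0$ for $r\le R$ and $\sigma(r)>0$ for $R<r\le\rho$, and let $\sigma$ be monotonically increasing on $[R,\rho]$. Take the second medium function in the PML system equal to the first one, $\hat\sigma=\sigma$. Then for all $T$ and $f$ as above every solution $(u,p,u^*,p^*)$ of the truncated PML problem has $u,p,u^*,p^*$ continuously differentiable in $t\in[0,T]$ with values in $L^2(\Omega_\rho^+)$, and $$\max_{0\le t\le T}\Big(\|\partial_tu\|_{L^2(\Omega_\rho^+)}+\|\partial_tp\|_{L^2(\Omega_\rho^+)}+\|\partial_tu^*\|_{L^2(\Omega_\rho^+)}+\|\partial_tp^*\|_{L^2(\Omega_\rho^+)}\Big)\le C\int_0^T\|\partial_tf+\sigma f\|_{L^2(\Omega_\rho^+)}\,dt .$$ -/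

import Mathlib

open MeasureTheory Set
open scoped ContDiff ENNReal

noncomputable section

namespace PML

/-- The Euclidean plane. -/
abbrev Plane := EuclideanSpace ℝ (Fin 2)

/-- `ℂ²` with its Euclidean norm. -/
abbrev CVec := EuclideanSpace ℂ (Fin 2)

/-! ### Geometry -/

/-- The domain above `Γ`: the connected component of the complement of `Γ` which contains all points
`(0, y)` with `y` sufficiently large. -/
def domainAbove (Γ : Set Plane) : Set Plane :=
  {x | ∃ y₀ : ℝ, ∀ y : ℝ, y₀ ≤ y → (!₂[0, y] : Plane) ∈ connectedComponentIn Γᶜ x}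

/-- `B_r^+`, the part of the domain above `Γ` in the open disc of radius `r` around the origin. -/
def upperBall (Γ : Set Plane) (r : ℝ) : Set Plane :=
  {x | x ∈ domainAbove Γ ∧ ‖x‖ < r}

/-- A locally perturbed half plane with an obstacle `D`, and the radii `R < ρ` of the absorbing
layer. The boundary `Γ₀` of the half plane is a non-selfintersecting regular `C²` curve that
coincides with the line `x₂ = 0` in `|x₁| > R`. -/
structure Geometry where
  γ : ℝ → Plane
  R : ℝ
  ρ : ℝ
  D : Set Plane
  R_pos : 0 < R
  R_lt_ρ : R < ρ
  contDiff_γ : ContDiff ℝ 2 γ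
  deriv_γ_ne_zero : ∀ t, deriv γ t ≠ 0
  injective_γ : Function.Injective γ
  flat : ∀ x : Plane, R < |x 0| → (x ∈ range γ ↔ x 1 = 0)
  isOpen_D : IsOpen D
  D_subset : D ⊆ upperBall (range γ) R

/-- `Ω_R^+ = B_R^+ \ closure D`, the physical domain. -/
def Geometry.physicalDomain (G : Geometry) : Set Plane :=
  upperBall (range G.γ) G.R \ closure G.D

/-- `Ω_ρ^+ = B_ρ^+ \ closure D`, the truncated domain (physical domain and absorbing layer). -/
def Geometry.truncatedDomain (G : Geometry) : Set Plane :=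
  upperBall (range G.γ) G.ρ \ closure G.D

/-! ### Function spaces -/

/-- `L²(U)`, complex valued. -/
abbrev L2 (U : Set Plane) := Lp ℂ 2 (volume.restrict U)

/-- `L²(U)²`, complex valued. -/
abbrev L2Vec (U : Set Plane) := Lp CVec 2 (volume.restrict U)

/-- `φ ∈ C_c^∞(U)`. -/
def IsTestFunction (U : Set Plane) (φ : Plane → ℂ) : Prop :=
  ContDiff ℝ ∞ φ ∧ HasCompactSupport φ ∧ tsupport φ ⊆ U

/-- The classical partial derivative `∂ᵢφ`. -/
def partialDeriv (i : Fin 2) (φ : Plane → ℂ) (x : Plane) : ℂ :=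
  fderiv ℝ φ x (EuclideanSpace.single i 1)

/-- `v ∈ H¹₀(U)` with weak gradient `g`: the pair `(v, g)` is a limit in `L² × L²` of pairs
`(φ, ∇φ)` with `φ ∈ C_c^∞(U)`, that is, `v` lies in the closure of `C_c^∞(U)` in the `H¹` norm. -/
def HasH10Gradient (U : Set Plane) (v : L2 U) (g : L2Vec U) : Prop :=
  (v, g) ∈ closure {w : L2 U × L2Vec U | ∃ φ : Plane → ℂ, IsTestFunction U φ ∧
    (∀ᵐ x ∂(volume.restrict U), w.1 x = φ x) ∧
    (∀ᵐ x ∂(volume.restrict U), ∀ i, w.2 x i = partialDeriv i φ x)}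

/-- `q ∈ H(div, U)` with weak divergence `d`. -/
def HasWeakDiv (U : Set Plane) (q : L2Vec U) (d : L2 U) : Prop :=
  ∀ φ : Plane → ℂ, IsTestFunction U φ →
    ∫ x in U, d x * φ x = - ∫ x in U, ∑ i, q x i * partialDeriv i φ x

/-- `v ∈ L²(0,T;X)`. -/
def MemL2Time {X : Type*} [NormedAddCommGroup X] (T : ℝ) (v : ℝ → X) : Prop :=
  MemLp v 2 (volume.restrict (Ioo 0 T))

/-- `v ∈ H¹(0,T;X)` with weak derivative `v'`, where `v` is the continuous representative on
`[0,T]`: `v' ∈ L²(0,T;X)` and `v` is a primitive of `v'`. -/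
def HasH1Deriv {X : Type*} [NormedAddCommGroup X] [NormedSpace ℝ X] (T : ℝ) (v v' : ℝ → X) :
    Prop :=
  MemL2Time T v' ∧ ∀ t ∈ Icc 0 T, v t = v 0 + ∫ s in (0 : ℝ)..t, v' s

/-! ### The truncated PML problem -/

/-- The rotation matrix with rows `(cos θ, sin θ)` and `(-sin θ, cos θ)`, where `θ` is the polar
angle of `x` (only used up to the null set `{0}`). -/
def polarMatrix (x : Plane) : Matrix (Fin 2) (Fin 2) ℝ :=
  !![x 0 / ‖x‖, x 1 / ‖x‖; -(x 1 / ‖x‖), x 0 / ‖x‖]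

/-- `Mᵀ diag(a, b) M` with `M` the rotation to the polar frame at `x`. -/
def polarDiag (a b : ℝ) (x : Plane) : Matrix (Fin 2) (Fin 2) ℝ :=
  (polarMatrix x).transpose * Matrix.diagonal ![a, b] * polarMatrix x

/-- `(u, p, u*, p*)` solves the truncated PML problem in `U × (0,T)` with source `f` and radial
medium functions `σ`, `σ'` (the latter being written `σ̂` in the equations):

* `u ∈ L²(0,T;H¹₀(U)) ∩ H¹(0,T;L²(U))` (this contains the Dirichlet condition on `∂U`),
  `p ∈ L²(0,T;H(div,U)) ∩ H¹(0,T;L²(U)²)`, `u* ∈ H¹(0,T;L²(U))`, `p* ∈ H¹(0,T;L²(U)²)`;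
* all four fields vanish at `t = 0`;
* `∂ₜu + (σ + σ̂) u + σ u* + div p = f`, `∂ₜp* = -∇u`, `∂ₜu* = σ u`,
  `∂ₜp + Λ₁ p = ∂ₜp* + Λ₂ p*` almost everywhere in `U × (0,T)`, with
  `Λ₁ = Mᵀ diag(σ, σ̂) M` and `Λ₂ = Mᵀ diag(σ̂, σ) M`. -/
def IsPMLSolution (U : Set Plane) (σ σ' : ℝ → ℝ) (T : ℝ) (f : ℝ → L2 U)
    (u : ℝ → L2 U) (p : ℝ → L2Vec U) (uS : ℝ → L2 U) (pS : ℝ → L2Vec U) : Prop :=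
  ∃ (du : ℝ → L2 U) (dp : ℝ → L2Vec U) (duS : ℝ → L2 U) (dpS : ℝ → L2Vec U)
    (gradu : ℝ → L2Vec U) (divp : ℝ → L2 U),
    HasH1Deriv T u du ∧ HasH1Deriv T p dp ∧ HasH1Deriv T uS duS ∧ HasH1Deriv T pS dpS ∧
    MemL2Time T gradu ∧ (∀ᵐ t ∂(volume.restrict (Ioo 0 T)), HasH10Gradient U (u t) (gradu t)) ∧
    MemL2Time T divp ∧ (∀ᵐ t ∂(volume.restrict (Ioo 0 T)), HasWeakDiv U (p t) (divp t)) ∧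
    u 0 = 0 ∧ p 0 = 0 ∧ uS 0 = 0 ∧ pS 0 = 0 ∧
    ∀ᵐ t ∂(volume.restrict (Ioo 0 T)), ∀ᵐ x ∂(volume.restrict U),
      (du t x + ((σ ‖x‖ + σ' ‖x‖ : ℝ) : ℂ) * u t x + ((σ ‖x‖ : ℝ) : ℂ) * uS t x + divp t x
        = f t x) ∧
      (∀ i, dpS t x i = - gradu t x i) ∧
      (duS t x = ((σ ‖x‖ : ℝ) : ℂ) * u t x) ∧
      (∀ i, dp t x i + ∑ j, ((polarDiag (σ ‖x‖) (σ' ‖x‖) x i j : ℝ) : ℂ) * p t x j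
        = dpS t x i + ∑ j, ((polarDiag (σ' ‖x‖) (σ ‖x‖) x i j : ℝ) : ℂ) * pS t x j)

/-- Absorption profiles: `σ = 0` for `r ≤ R`, `σ > 0` in the layer, and `σ` is monotonically
increasing on `[R, ρ]`. -/
def IsAbsorption (R ρ : ℝ) (σ : ℝ → ℝ) : Prop :=
  (∀ r ≤ R, σ r = 0) ∧ (∀ r ∈ Ioc R ρ, 0 < σ r) ∧ MonotoneOn σ (Icc R ρ)

/-- Sources `f ∈ H¹(0,T;L²)` on the truncated domain, with time derivative `f'`, `f(0) = 0`, and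
support in a fixed compact subset of the physical domain. -/
def IsSource (G : Geometry) (T : ℝ) (f f' : ℝ → L2 G.truncatedDomain) : Prop :=
  HasH1Deriv T f f' ∧ f 0 = 0 ∧
  ∃ K : Set Plane, IsCompact K ∧ K ⊆ G.physicalDomain ∧
    ∀ t ∈ Icc 0 T, ∀ᵐ x ∂(volume.restrict G.truncatedDomain), x ∉ K → f t x = 0

end PML

end

noncomputable section

namespace PML

open Filter Topology intervalIntegral

/-! ### Difference quotients in time, and the energy inequality. -/

section Evolution

variable {X : Type*} [NormedAddCommGroup X]

/-! With equal medium functions both matrices `Λ₁`, `Λ₂` equal `σ` times the identity, so `p - p*`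
solves `w' + σ w = 0` with zero initial value and vanishes (`eq_of_damped`). Hence `∂ₜp = -∇u`, and
`U = (u, u*, p)` solves `U' + A U = F` with `A U = (2σu + σu* + div p, -σu, ∇u)` and `F = (f, 0,
0)`. This `A` is monotone: the `σ` couplings of `u` and `u*` cancel, `div` and `∇` cancel by
integration by parts, and `2∫ σ|u|²` remains (`inner_pmlGraph_nonneg`).

For a linear monotone equation with zero initial value, the sup norm of the solution is at most
twice the `L¹` norm in time of the source (`norm_primitive_le`). Extended by zero to negative times,
the backward difference quotients of `U` solve the same equation with the quotients of `F` as
sources. The latter are Cauchy in `L¹` (`backDiff_primitive_cauchy`), so the former converge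
uniformly. The limit is a continuous derivative of `U`, bounded by `2∫ ‖f'‖`
(`exists_continuous_derivative`).

Finally `σ f = 0`, because `f` lives where `σ` vanishes. The constant is therefore independent even
of the geometry. -/

lemma primitive_sub_shift [NormedSpace ℝ X] {a : ℝ → X} (ha : Integrable a) (h s : ℝ) :
    (∫ r in (0 : ℝ)..s, a r) - ∫ r in (0 : ℝ)..(s - h), a r = ∫ r in (s - h)..s, a r :=
  integral_interval_sub_left ha.intervalIntegrable ha.intervalIntegrable

lemma primitive_shift [NormedSpace ℝ X] {a : ℝ → X} (ha : Integrable a) (h0 : ∀ s ≤ 0, a s = 0) {h : ℝ}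
    (hh : 0 ≤ h) (t : ℝ) :
    ∫ s in (0 : ℝ)..t, a (s - h) = ∫ s in (0 : ℝ)..(t - h), a s := by
  rw [integral_comp_sub_right (fun s => a s) h]
  have : ∫ s in (0 - h)..0, a s = 0 := by
    rw [integral_congr (g := fun _ => (0 : X))]
    · simp
    · intro s hs
      rw [uIcc_of_le (by linarith)] at hs
      exact h0 s hs.2
  rw [← integral_add_adjacent_intervals (b := 0) ha.intervalIntegrable ha.intervalIntegrable,
    this, zero_add]

/-- The averages over backward windows of length `h` do not increase the `L¹` norm. -/
lemma integral_window_average_le {φ : ℝ → ℝ} (hφ : Integrable φ) (hpos : ∀ s, 0 ≤ φ s)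
    {h : ℝ} (hh : 0 < h) (T : ℝ) :
    ∫ s in (0 : ℝ)..T, h⁻¹ * ∫ r in (s - h)..s, φ r ≤ ∫ s, φ s := by
  set Φ : ℝ → ℝ := fun s => ∫ r in (0 : ℝ)..s, φ r with hΦ
  have hc : Continuous Φ := continuous_primitive (fun _ _ => hφ.intervalIntegrable) 0
  have hi : ∀ a b, IntervalIntegrable Φ volume a b := fun a b => hc.intervalIntegrable a b
  have hle : ∀ a b, a ≤ b → Φ b - Φ a ≤ ∫ s, φ s := by
    intro a b hab
    rw [hΦ, integral_interval_sub_left hφ.intervalIntegrable hφ.intervalIntegrable,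
      integral_of_le hab]
    exact setIntegral_le_integral hφ (Eventually.of_forall hpos)
  have hmono : Monotone Φ := by
    intro a b hab
    have : Φ b - Φ a = ∫ r in a..b, φ r :=
      integral_interval_sub_left hφ.intervalIntegrable hφ.intervalIntegrable
    have := integral_nonneg (μ := volume) hab (fun s _ => hpos s)
    linarith
  rw [intervalIntegral.integral_const_mul]
  -- The integral telescopes to that of `Φ` over the last window minus that over the window before
  -- `0`; monotonicity of `Φ` bounds each by an endpoint value.
  have e1 : ∫ s in (0 : ℝ)..T, ∫ r in (s - h)..s, φ r
      = (∫ s in (T - h)..T, Φ s) - ∫ s in (-h)..0, Φ s := by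
    have : ∀ s, ∫ r in (s - h)..s, φ r = Φ s - Φ (s - h) := fun s =>
      (primitive_sub_shift hφ h s).symm
    simp_rw [this]
    have hs : Continuous fun s => Φ (s - h) := by fun_prop
    rw [integral_sub (hi _ _) (hs.intervalIntegrable _ _),
      integral_comp_sub_right (fun s => Φ s) h, zero_sub]
    have h1 := integral_add_adjacent_intervals (hi (-h) 0) (hi 0 T)
    have h2 := integral_add_adjacent_intervals (hi (-h) (T - h)) (hi (T - h) T)
    linarith
  have e2 : ∫ s in (T - h)..T, Φ s ≤ ∫ s in (T - h)..T, Φ T :=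
    integral_mono_on (by linarith) (hi _ _) (by simp) (fun s hs => hmono hs.2)
  have e3 : ∫ s in (-h)..0, Φ (-h) ≤ ∫ s in (-h)..0, Φ s :=
    integral_mono_on (by linarith) (by simp) (hi _ _) (fun s hs => hmono hs.1)
  simp only [intervalIntegral.integral_const, smul_eq_mul, sub_sub_cancel, sub_neg_eq_add, zero_add] at e2 e3
  rcases le_total (-h) T with hT | hT
  · rw [e1, inv_mul_le_iff₀ hh]
    have := mul_le_mul_of_nonneg_left (hle _ _ hT) hh.le
    linarith
  · have : Φ T ≤ Φ (-h) := hmono hT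
    rw [e1, inv_mul_le_iff₀ hh]
    have h3 : 0 ≤ ∫ s, φ s := integral_nonneg hpos
    nlinarith

/-- The backward difference quotient. -/
def backDiff [NormedSpace ℝ X] (h : ℝ) (v : ℝ → X) (s : ℝ) : X := h⁻¹ • (v s - v (s - h))

section Normed

variable [NormedSpace ℝ X]

lemma continuous_backDiff {v : ℝ → X} (hv : Continuous v) (h : ℝ) : Continuous (backDiff h v) := by
  unfold backDiff; fun_prop

lemma norm_backDiff_primitive_le {b : ℝ → X} (hb : Integrable b) {h : ℝ} (hh : 0 < h) (s : ℝ) :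
    ‖backDiff h (fun s => ∫ r in (0 : ℝ)..s, b r) s‖ ≤ h⁻¹ * ∫ r in (s - h)..s, ‖b r‖ := by
  rw [backDiff, primitive_sub_shift hb, norm_smul, norm_inv, Real.norm_of_nonneg hh.le]
  gcongr
  exact norm_integral_le_integral_norm (by linarith)

lemma continuous_window {φ : ℝ → ℝ} (hφ : Integrable φ) (h : ℝ) :
    Continuous fun s => h⁻¹ * ∫ r in (s - h)..s, φ r := by
  have hc : Continuous fun s => ∫ r in (0 : ℝ)..s, φ r :=
    continuous_primitive (fun _ _ => hφ.intervalIntegrable) 0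
  simp_rw [← primitive_sub_shift hφ h]
  fun_prop

lemma continuous_primitive_of_integrable {b : ℝ → X} (hb : Integrable b) :
    Continuous fun s => ∫ r in (0 : ℝ)..s, b r :=
  continuous_primitive (fun _ _ => hb.intervalIntegrable) 0

/-- The bound is uniform in `h`, since window averaging does not increase the `L¹` norm. This is
what permits approximation of `b` in `L¹`. -/
lemma integral_norm_backDiff_le {b : ℝ → X} (hb : Integrable b) {h T : ℝ} (hh : 0 < h)
    (hT : 0 ≤ T) :
    ∫ s in (0 : ℝ)..T, ‖backDiff h (fun s => ∫ r in (0 : ℝ)..s, b r) s‖ ≤ ∫ s, ‖b s‖ := by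
  refine le_trans (integral_mono_on hT ?_ ?_ fun s _ => norm_backDiff_primitive_le hb hh s)
    (integral_window_average_le hb.norm (fun s => norm_nonneg _) hh T)
  · exact (continuous_backDiff (continuous_primitive_of_integrable hb) h).norm.intervalIntegrable _ _
  · exact (continuous_window hb.norm h).intervalIntegrable _ _

lemma backDiff_primitive_sub {b g : ℝ → X} (hb : Integrable b) (hg : Integrable g) (h s : ℝ) :
    backDiff h (fun s => ∫ r in (0 : ℝ)..s, (b r - g r)) s
      = backDiff h (fun s => ∫ r in (0 : ℝ)..s, b r) s
        - backDiff h (fun s => ∫ r in (0 : ℝ)..s, g r) s := by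
  simp only [backDiff]
  rw [integral_sub hb.intervalIntegrable hg.intervalIntegrable,
    integral_sub hb.intervalIntegrable hg.intervalIntegrable]
  module

variable [CompleteSpace X]

/-- The difference quotients of a primitive of a uniformly continuous function converge
uniformly. -/
lemma norm_backDiff_primitive_sub_le {g : ℝ → X} (hg : UniformContinuous g) (hgi : Integrable g)
    {η : ℝ} (hη : 0 < η) :
    ∃ δ > 0, ∀ h, 0 < h → h < δ → ∀ s,
      ‖backDiff h (fun s => ∫ r in (0 : ℝ)..s, g r) s - g s‖ ≤ η := by
  obtain ⟨δ, hδ, H⟩ := Metric.uniformContinuous_iff.1 hg η hη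
  refine ⟨δ, hδ, fun h hh hhδ s => ?_⟩
  have e : backDiff h (fun s => ∫ r in (0 : ℝ)..s, g r) s - g s
      = h⁻¹ • ∫ r in (s - h)..s, (g r - g s) := by
    rw [backDiff, primitive_sub_shift hgi,
      integral_sub hgi.intervalIntegrable intervalIntegrable_const, intervalIntegral.integral_const, smul_sub,
      sub_sub_cancel, smul_smul, inv_mul_cancel₀ hh.ne', one_smul]
  rw [e, norm_smul, norm_inv, Real.norm_of_nonneg hh.le, inv_mul_le_iff₀ hh]
  have := norm_integral_le_of_norm_le_const (a := s - h) (b := s) (f := fun r => g r - g s)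
    (C := η) (by
      intro r hr
      rw [uIoc_of_le (by linarith)] at hr
      rw [← dist_eq_norm]
      refine (H ?_).le
      rw [Real.dist_eq, abs_sub_comm, abs_of_nonneg (by linarith [hr.2])]
      linarith [hr.1])
  rw [sub_sub_cancel, abs_of_pos hh] at this
  linarith

/-- Approximate `b` in `L¹` by a continuous compactly supported `g`. The quotient for `b - g` costs
at most `ε / 4` for every `h`; the one for `g` is uniformly close to `g` for small `h`. Every such
quotient is then within `ε / 2` of `g` in `L¹(0,T)`. -/
lemma backDiff_primitive_cauchy {b : ℝ → X} (hb : Integrable b) {T : ℝ} (hT : 0 < T) {ε : ℝ}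
    (hε : 0 < ε) :
    ∃ δ > 0, ∀ h k, 0 < h → h < δ → 0 < k → k < δ →
      ∫ s in (0 : ℝ)..T, ‖backDiff h (fun s => ∫ r in (0 : ℝ)..s, b r) s
        - backDiff k (fun s => ∫ r in (0 : ℝ)..s, b r) s‖ ≤ ε := by
  obtain ⟨g, hgc, hbg, hg, hgi⟩ := hb.exists_hasCompactSupport_integral_sub_le
    (show 0 < ε / 4 by positivity)
  obtain ⟨δ, hδ, H⟩ := norm_backDiff_primitive_sub_le (hgc.uniformContinuous_of_continuous hg)
    hgi (show 0 < ε / (4 * T) by positivity)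
  have hbc : ∀ h, Continuous (backDiff h fun s => ∫ r in (0 : ℝ)..s, b r) := fun h =>
    continuous_backDiff (continuous_primitive_of_integrable hb) h
  have key : ∀ h, 0 < h → h < δ →
      ∫ s in (0 : ℝ)..T, ‖backDiff h (fun s => ∫ r in (0 : ℝ)..s, b r) s - g s‖ ≤ ε / 2 := by
    intro h hh hhδ
    have h1 := integral_norm_backDiff_le (hb.sub hgi) hh hT.le
    have hdc : Continuous (backDiff h fun s => ∫ r in (0 : ℝ)..s, (b r - g r)) :=
      continuous_backDiff (continuous_primitive_of_integrable (hb.sub hgi)) h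
    have h2 : ∫ s in (0 : ℝ)..T, ‖backDiff h (fun s => ∫ r in (0 : ℝ)..s, b r) s - g s‖
        ≤ ∫ s in (0 : ℝ)..T, (‖backDiff h (fun s => ∫ r in (0 : ℝ)..s, (b r - g r)) s‖
          + ε / (4 * T)) := by
      refine integral_mono_on hT.le (((hbc h).sub hg).norm.intervalIntegrable _ _)
        ((hdc.norm.add continuous_const).intervalIntegrable _ _) fun s _ => ?_
      have := H h hh hhδ s
      rw [backDiff_primitive_sub hb hgi]
      refine (norm_sub_le_norm_sub_add_norm_sub _ _ _).trans (add_le_add_right this _)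
    rw [integral_add (hdc.norm.intervalIntegrable _ _) intervalIntegrable_const,
      intervalIntegral.integral_const] at h2
    have h3 : (T - 0) • (ε / (4 * T)) = ε / 4 := by
      rw [smul_eq_mul]; field_simp; ring
    rw [h3] at h2
    simp only [Pi.sub_apply] at h1
    linarith
  refine ⟨δ, hδ, fun h k hh hhδ hk hkδ => ?_⟩
  have h1 := key h hh hhδ
  have h2 := key k hk hkδ
  have h3 : ∫ s in (0 : ℝ)..T, ‖backDiff h (fun s => ∫ r in (0 : ℝ)..s, b r) s
        - backDiff k (fun s => ∫ r in (0 : ℝ)..s, b r) s‖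
      ≤ ∫ s in (0 : ℝ)..T, (‖backDiff h (fun s => ∫ r in (0 : ℝ)..s, b r) s - g s‖
        + ‖backDiff k (fun s => ∫ r in (0 : ℝ)..s, b r) s - g s‖) := by
    refine integral_mono_on hT.le (((hbc h).sub (hbc k)).norm.intervalIntegrable _ _)
        ((((hbc h).sub hg).norm.add ((hbc k).sub hg).norm).intervalIntegrable _ _) fun s _ => ?_
    rw [norm_sub_rev (backDiff k _ s)]
    exact norm_sub_le_norm_sub_add_norm_sub _ _ _
  refine h3.trans ?_
  refine (integral_add (((hbc h).sub hg).norm.intervalIntegrable _ _)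
    (((hbc k).sub hg).norm.intervalIntegrable _ _)).trans_le ?_
  simp only [Pi.sub_apply]
  linarith

lemma contDiffOn_of_eq_primitive {v w : ℝ → X} (hw : Continuous w) {T : ℝ} (hT : 0 < T)
    (hv : ∀ t ∈ Icc 0 T, v t = ∫ s in (0 : ℝ)..t, w s) :
    ContDiffOn ℝ 1 v (Icc 0 T) ∧ ∀ t ∈ Icc 0 T, derivWithin v (Icc 0 T) t = w t := by
  have hd : ∀ t, HasDerivAt (fun t => ∫ s in (0 : ℝ)..t, w s) (w t) t := fun t =>
    hw.integral_hasStrictDerivAt 0 t |>.hasDerivAt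
  constructor
  · refine ContDiffOn.congr (f := fun t => ∫ s in (0 : ℝ)..t, w s) (ContDiff.contDiffOn ?_) hv
    rw [contDiff_one_iff_deriv]
    refine ⟨fun t => (hd t).differentiableAt, ?_⟩
    rwa [funext fun t => (hd t).deriv]
  · intro t ht
    rw [derivWithin_congr hv (hv t ht)]
    exact (hd t).hasDerivWithinAt.derivWithin (uniqueDiffOn_Icc hT t ht)

end Normed

section Inner

variable [InnerProductSpace ℝ X] [CompleteSpace X]

/-- As `a` is only integrable, the primitive need not be differentiable everywhere. Its squared norm
is still absolutely continuous, and its derivative is known almost everywhere by Lebesgue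
differentiation. -/
lemma norm_sq_primitive {a : ℝ → X} (ha : Integrable a) {T : ℝ} (hT : 0 ≤ T) :
    ‖∫ s in (0 : ℝ)..T, a s‖ ^ 2
      = ∫ t in (0 : ℝ)..T, 2 * inner ℝ (∫ s in (0 : ℝ)..t, a s) (a t) := by
  set V : ℝ → X := fun t => ∫ s in (0 : ℝ)..t, a s with hV
  have hc : Continuous V := continuous_primitive_of_integrable ha
  obtain ⟨M, hM⟩ := (isCompact_Icc (a := 0) (b := T)).exists_bound_of_continuousOn
    hc.continuousOn
  have hM0 : 0 ≤ M := (norm_nonneg _).trans (hM 0 ⟨le_rfl, hT⟩)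
  -- Increments of `‖V‖²` are dominated by those of `2M ∫ ‖a‖`, which is absolutely continuous.
  have hac : AbsolutelyContinuousOnInterval (fun t => ‖V t‖ ^ 2) 0 T := by
    have h1 : AbsolutelyContinuousOnInterval (fun t => 2 * M * ∫ s in (0 : ℝ)..t, ‖a s‖) 0 T :=
      (IntervalIntegrable.absolutelyContinuousOnInterval_intervalIntegral
        (ha.norm.intervalIntegrable) (by simp)).const_mul (2 * M)
    refine squeeze_zero' (Eventually.of_forall fun E => Finset.sum_nonneg fun i _ => dist_nonneg)
      ?_ h1
    filter_upwards [mem_inf_of_right (mem_principal_self _)] with E hE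
    refine Finset.sum_le_sum fun i hi => ?_
    have hm := hE.1 i hi
    rw [uIcc_of_le hT] at hm
    have key : ∀ x ∈ Icc 0 T, ∀ y ∈ Icc 0 T, ‖‖V x‖ ^ 2 - ‖V y‖ ^ 2‖
        ≤ ‖2 * M * (∫ s in (0 : ℝ)..x, ‖a s‖) - 2 * M * ∫ s in (0 : ℝ)..y, ‖a s‖‖ := by
      intro x hx y hy
      have e1 : V x - V y = ∫ s in y..x, a s :=
        integral_interval_sub_left ha.intervalIntegrable ha.intervalIntegrable
      have e2 : (∫ s in (0 : ℝ)..x, ‖a s‖) - ∫ s in (0 : ℝ)..y, ‖a s‖ = ∫ s in y..x, ‖a s‖ :=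
        integral_interval_sub_left ha.norm.intervalIntegrable ha.norm.intervalIntegrable
      rw [← mul_sub, e2, norm_mul, Real.norm_of_nonneg (by positivity : 0 ≤ 2 * M),
        sq_sub_sq, norm_mul]
      have e3 : ‖‖V x‖ - ‖V y‖‖ ≤ ‖∫ s in y..x, ‖a s‖‖ := by
        refine (abs_norm_sub_norm_le _ _).trans ?_
        rw [e1]
        exact norm_integral_le_abs_integral_norm
      refine mul_le_mul ?_ e3 (norm_nonneg _) (by positivity)
      rw [Real.norm_of_nonneg (by positivity)]
      linarith [hM x hx, hM y hy]
    simpa only [dist_eq_norm] using key _ hm.1 _ hm.2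
  have hI := hac.integral_deriv_eq_sub
  have h0 : V 0 = 0 := by simp [hV]
  rw [h0, norm_zero, zero_pow two_ne_zero, sub_zero] at hI
  rw [← hI]
  refine integral_congr_ae ?_
  filter_upwards [LocallyIntegrable.ae_hasDerivAt_integral ha.locallyIntegrable] with t ht _
  exact ((ht 0).norm_sq).deriv

/-- The energy inequality. -/
lemma norm_primitive_le {a G : ℝ → X} (ha : Integrable a) {T : ℝ}
    (hG : IntervalIntegrable G volume 0 T)
    (hmon : ∀ᵐ s, 0 < s → s < T → 0 ≤ inner ℝ (G s - a s) (∫ r in (0 : ℝ)..s, a r))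
    {t : ℝ} (ht : t ∈ Icc 0 T) :
    ‖∫ s in (0 : ℝ)..t, a s‖ ≤ 2 * ∫ s in (0 : ℝ)..T, ‖G s‖ := by
  -- At a maximum point `t₀` of `‖V‖` the energy identity gives `‖V t₀‖² ≤ 2 ‖V t₀‖ ∫ ‖G‖`, and one
  -- factor can be divided out.
  have hc : Continuous fun t => ∫ s in (0 : ℝ)..t, a s := continuous_primitive_of_integrable ha
  obtain ⟨t₀, ht₀, hmax⟩ := (isCompact_Icc (a := 0) (b := T)).exists_isMaxOn
    ⟨t, ht⟩ hc.norm.continuousOn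
  set V : ℝ → X := fun t => ∫ s in (0 : ℝ)..t, a s with hV
  have hmax' : ∀ s ∈ Icc 0 T, ‖V s‖ ≤ ‖V t₀‖ := fun s hs => hmax hs
  refine (hmax' t ht).trans ?_
  have hT : 0 ≤ T := ht.1.trans ht.2
  have hG0 : 0 ≤ ∫ s in (0 : ℝ)..T, ‖G s‖ := integral_nonneg hT fun s _ => norm_nonneg _
  have hsub : uIcc 0 t₀ ⊆ uIcc 0 T := by
    rw [uIcc_of_le ht₀.1, uIcc_of_le hT]; exact Icc_subset_Icc le_rfl ht₀.2
  have h1 : ‖V t₀‖ ^ 2 ≤ ∫ s in (0 : ℝ)..t₀, 2 * ‖V t₀‖ * ‖G s‖ := by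
    rw [hV, norm_sq_primitive ha ht₀.1, ← hV]
    refine integral_mono_ae_restrict ht₀.1 ?_ ?_ ?_
    · refine IntervalIntegrable.const_mul ?_ 2
      have hb : ∀ s ∈ Icc 0 T, ‖V s‖ ≤ ‖V t₀‖ := hmax'
      rw [intervalIntegrable_iff]
      refine Integrable.mono' (g := fun s => ‖V t₀‖ * ‖a s‖)
        ((ha.norm.const_mul _).integrableOn)
        (hc.aestronglyMeasurable.inner ha.aestronglyMeasurable.restrict) ?_
      refine (ae_restrict_iff' measurableSet_uIoc).2 (Eventually.of_forall fun s hs => ?_)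
      have := hsub (uIoc_subset_uIcc hs)
      rw [uIcc_of_le hT] at this
      exact (norm_inner_le_norm _ _).trans (by gcongr; exact hb s this)
    · exact (hG.mono_set hsub).norm.const_mul _
    · have h0 : ∀ᵐ s ∂(volume : Measure ℝ), s ≠ T := by
        simp [ae_iff]
      refine (ae_restrict_iff' measurableSet_Icc).2 ?_
      have h00 : ∀ᵐ s ∂(volume : Measure ℝ), s ≠ 0 := by
        simp [ae_iff]
      filter_upwards [hmon, h0, h00] with s hs hsT hs0 hsI
      have hsI' : s ∈ Icc 0 T := ⟨hsI.1, hsI.2.trans ht₀.2⟩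
      have h2 := hs (lt_of_le_of_ne hsI.1 (Ne.symm hs0)) (lt_of_le_of_ne hsI'.2 hsT)
      rw [inner_sub_left, real_inner_comm (V s) (a s)] at h2
      have h3 : inner ℝ (G s) (V s) ≤ ‖G s‖ * ‖V t₀‖ :=
        (real_inner_le_norm _ _).trans (by gcongr; exact hmax' s hsI')
      show 2 * inner ℝ (V s) (a s) ≤ 2 * ‖V t₀‖ * ‖G s‖
      linarith
  rw [intervalIntegral.integral_const_mul] at h1
  have h2 : ∫ s in (0 : ℝ)..t₀, ‖G s‖ ≤ ∫ s in (0 : ℝ)..T, ‖G s‖ :=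
    integral_mono_interval le_rfl ht₀.1 ht₀.2 (Eventually.of_forall fun s => norm_nonneg _) hG.norm
  rcases (norm_nonneg (V t₀)).eq_or_lt with h | h
  · rw [← h]; positivity
  · have h3 : ‖V t₀‖ * ‖V t₀‖ ≤ ‖V t₀‖ * (2 * ∫ s in (0 : ℝ)..T, ‖G s‖) := by
      have := mul_le_mul_of_nonneg_left h2 h.le
      nlinarith
    exact le_of_mul_le_mul_left h3 h

end Inner

end Evolution

/-! ### Regularity for linear monotone evolution equations. -/

section Monotone

variable {X : Type*} [NormedAddCommGroup X] [InnerProductSpace ℝ X]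

/-- Vanishing for nonpositive times makes the shift commute with the primitive from `0`. The
quotient is thus again a primitive starting at zero, as the energy inequality requires. -/
lemma backDiff_primitive_eq {a : ℝ → X} (ha : Integrable a) (h0 : ∀ s ≤ 0, a s = 0) {h : ℝ}
    (hh : 0 < h) (t : ℝ) :
    backDiff h (fun s => ∫ r in (0 : ℝ)..s, a r) t = ∫ s in (0 : ℝ)..t, backDiff h a s := by
  simp only [backDiff]
  rw [intervalIntegral.integral_smul,
    integral_sub ha.intervalIntegrable (ha.comp_sub_right h).intervalIntegrable,
    primitive_shift ha h0 hh.le]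

lemma integrable_backDiff {a : ℝ → X} (ha : Integrable a) (h : ℝ) : Integrable (backDiff h a) :=
  (ha.sub (ha.comp_sub_right h)).smul _

/-- The backward difference quotients of a solution of `U' + A U = F` solve the equation whose
source is the difference quotient of `F`. -/
lemma backDiff_mem {A : Submodule ℝ (X × X)} {a b : ℝ → X} {T : ℝ}
    (hsol : ∀ᵐ s, s < T →
      ((∫ r in (0 : ℝ)..s, a r), (∫ r in (0 : ℝ)..s, b r) - a s) ∈ A) {h : ℝ} (hh : 0 < h) :
    ∀ᵐ s, s < T → (backDiff h (fun s => ∫ r in (0 : ℝ)..s, a r) s,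
      backDiff h (fun s => ∫ r in (0 : ℝ)..s, b r) s - backDiff h a s) ∈ A := by
  -- Translation preserves null sets, and `s - h < T` follows from `s < T`: backward quotients never
  -- need the equation beyond `T`.
  have hshift := (measurePreserving_sub_right (volume : Measure ℝ) h).quasiMeasurePreserving.ae hsol
  filter_upwards [hsol, hshift] with s h1 h2 hs
  have := A.smul_mem h⁻¹ (A.sub_mem (h1 hs) (h2 (by linarith)))
  convert this using 1
  simp only [backDiff, Prod.mk_sub_mk, Prod.smul_mk, ← smul_sub]
  congr 2
  abel

variable [CompleteSpace X] {A : Submodule ℝ (X × X)} {a b : ℝ → X} {T : ℝ}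

/-- By linearity of `A`, the difference of two quotients solves the equation whose source is the
difference of the source quotients; the energy inequality applies to it. -/
lemma norm_backDiff_sub_le (hA : ∀ z ∈ A, 0 ≤ inner ℝ z.2 z.1) (ha : Integrable a)
    (hb : Integrable b) (ha0 : ∀ s ≤ 0, a s = 0)
    (hsol : ∀ᵐ s, s < T →
      ((∫ r in (0 : ℝ)..s, a r), (∫ r in (0 : ℝ)..s, b r) - a s) ∈ A)
    {h k : ℝ} (hh : 0 < h) (hk : 0 < k) {t : ℝ} (ht : t ∈ Icc 0 T) :
    ‖backDiff h (fun s => ∫ r in (0 : ℝ)..s, a r) t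
        - backDiff k (fun s => ∫ r in (0 : ℝ)..s, a r) t‖
      ≤ 2 * ∫ s in (0 : ℝ)..T, ‖backDiff h (fun s => ∫ r in (0 : ℝ)..s, b r) s
        - backDiff k (fun s => ∫ r in (0 : ℝ)..s, b r) s‖ := by
  have hbc : ∀ h, Continuous (backDiff h fun s => ∫ r in (0 : ℝ)..s, b r) := fun h =>
    continuous_backDiff (continuous_primitive_of_integrable hb) h
  have e : ∀ t, backDiff h (fun s => ∫ r in (0 : ℝ)..s, a r) t
      - backDiff k (fun s => ∫ r in (0 : ℝ)..s, a r) t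
      = ∫ s in (0 : ℝ)..t, (backDiff h a s - backDiff k a s) := by
    intro t
    rw [integral_sub (integrable_backDiff ha h).intervalIntegrable
      (integrable_backDiff ha k).intervalIntegrable, backDiff_primitive_eq ha ha0 hh,
      backDiff_primitive_eq ha ha0 hk]
  rw [e]
  refine norm_primitive_le ((integrable_backDiff ha h).sub (integrable_backDiff ha k))
    (((hbc h).sub (hbc k)).intervalIntegrable _ _) ?_ ht
  filter_upwards [backDiff_mem hsol hh, backDiff_mem hsol hk] with s h1 h2 _ hs
  have := hA _ (A.sub_mem (h1 hs) (h2 hs))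
  simp only [Prod.mk_sub_mk, e] at this
  convert this using 2
  · simp only [Pi.sub_apply]
    abel
  · rfl

lemma norm_backDiff_le (hA : ∀ z ∈ A, 0 ≤ inner ℝ z.2 z.1) (ha : Integrable a)
    (hb : Integrable b) (ha0 : ∀ s ≤ 0, a s = 0)
    (hsol : ∀ᵐ s, s < T →
      ((∫ r in (0 : ℝ)..s, a r), (∫ r in (0 : ℝ)..s, b r) - a s) ∈ A)
    {h : ℝ} (hh : 0 < h) {t : ℝ} (ht : t ∈ Icc 0 T) :
    ‖backDiff h (fun s => ∫ r in (0 : ℝ)..s, a r) t‖ ≤ 2 * ∫ s, ‖b s‖ := by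
  rw [backDiff_primitive_eq ha ha0 hh]
  refine (norm_primitive_le (integrable_backDiff ha h) ((continuous_backDiff
    (continuous_primitive_of_integrable hb) h).intervalIntegrable _ _) ?_ ht).trans
    (mul_le_mul_of_nonneg_left (integral_norm_backDiff_le hb hh (ht.1.trans ht.2)) zero_le_two)
  filter_upwards [backDiff_mem hsol hh] with s h1 _ hs
  have := hA _ (h1 hs)
  rwa [backDiff_primitive_eq ha ha0 hh] at this

/-- Regularity for `U' + A U = F` with `A` linear and monotone, `U(0) = F(0) = 0`, `U' = a` and
`F' = b`: the derivative of `U` is continuous and bounded by the `L¹` norm of `F'`. -/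
theorem exists_continuous_derivative (hA : ∀ z ∈ A, 0 ≤ inner ℝ z.2 z.1) (ha : Integrable a)
    (hb : Integrable b) (ha0 : ∀ s ≤ 0, a s = 0) (hT : 0 < T)
    (hsol : ∀ᵐ s, s < T →
      ((∫ r in (0 : ℝ)..s, a r), (∫ r in (0 : ℝ)..s, b r) - a s) ∈ A) :
    ∃ w : ℝ → X, Continuous w ∧
      (∀ t ∈ Icc 0 T, ∫ s in (0 : ℝ)..t, a s = ∫ s in (0 : ℝ)..t, w s) ∧
      ∀ t ∈ Icc 0 T, ‖w t‖ ≤ 2 * ∫ s, ‖b s‖ := by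
  set W : ℕ → ℝ → X := fun n => backDiff (1 / ((n : ℝ) + 1)) fun s => ∫ r in (0 : ℝ)..s, a r
    with hW
  have hpos : ∀ n : ℕ, 0 < 1 / ((n : ℝ) + 1) := fun n => by positivity
  have hcauchy : UniformCauchySeqOn W atTop (Icc 0 T) := by
    rw [Metric.uniformCauchySeqOn_iff]
    intro ε hε
    obtain ⟨δ, hδ, H⟩ := backDiff_primitive_cauchy hb hT (show 0 < ε / 4 by positivity)
    obtain ⟨N, hN⟩ := exists_nat_one_div_lt hδ
    refine ⟨N, fun m hm n hn t ht => ?_⟩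
    have hlt : ∀ m : ℕ, N ≤ m → 1 / ((m : ℝ) + 1) < δ := fun m hm =>
      (Nat.one_div_le_one_div hm).trans_lt hN
    have h1 := norm_backDiff_sub_le hA ha hb ha0 hsol (hpos m) (hpos n) ht
    have h2 := H _ _ (hpos m) (hlt m hm) (hpos n) (hlt n hn)
    rw [dist_eq_norm]
    refine h1.trans_lt ?_
    linarith
  have hlim : ∀ t ∈ Icc 0 T, ∃ x, Tendsto (fun n => W n t) atTop (𝓝 x) := fun t ht =>
    cauchySeq_tendsto_of_complete (hcauchy.cauchySeq ht)
  choose! w₀ hw₀ using hlim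
  have hunif := hcauchy.tendstoUniformlyOn_of_tendsto hw₀
  have hw₀c : ContinuousOn w₀ (Icc 0 T) := hunif.continuousOn <| Frequently.of_forall fun n =>
    (continuous_backDiff (continuous_primitive_of_integrable ha) _).continuousOn
  -- The limit is controlled only on `[0,T]`; composing with the projection onto it gives a
  -- continuous function on the whole line.
  have hext : ∀ t ∈ Icc 0 T, w₀ (projIcc 0 T hT.le t) = w₀ t := fun t ht => by
    rw [projIcc_of_mem hT.le ht]
  refine ⟨fun t => w₀ (projIcc 0 T hT.le t), ?_, ?_, ?_⟩
  · exact (continuousOn_iff_continuous_domRestrict.1 hw₀c).comp continuous_projIcc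
  · intro t ht
    refine integral_congr_ae ?_
    -- At almost every `s` the primitive has derivative `a s`, so the quotients, with increments
    -- tending to zero from below, converge to `a s` as well as to `w₀ s`.
    filter_upwards [LocallyIntegrable.ae_hasDerivAt_integral ha.locallyIntegrable] with s hs hst
    rw [uIoc_of_le ht.1] at hst
    have hsT : s ∈ Icc 0 T := ⟨hst.1.le, hst.2.trans ht.2⟩
    rw [hext s hsT]
    refine tendsto_nhds_unique ?_ (hw₀ s hsT)
    have h1 := (hasDerivAt_iff_tendsto_slope_zero.1 (hs 0))
    have h2 : Tendsto (fun n : ℕ => -(1 / ((n : ℝ) + 1))) atTop (𝓝[≠] 0) := by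
      refine tendsto_nhdsWithin_iff.2 ⟨?_, Eventually.of_forall fun n => ?_⟩
      · simpa using (tendsto_one_div_add_atTop_nhds_zero_nat (𝕜 := ℝ)).neg
      · exact neg_ne_zero.2 (hpos n).ne'
    refine (h1.comp h2).congr fun n => ?_
    simp only [hW, backDiff, Function.comp_apply, inv_neg, neg_smul, ← smul_neg, neg_sub,
      ← sub_eq_add_neg]
  · intro t ht
    simp only [hext t ht]
    exact le_of_tendsto (hw₀ t ht).norm
      (Eventually.of_forall fun n => norm_backDiff_le hA ha hb ha0 hsol (hpos n) ht)

end Monotone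

/-! ### Weak gradient and divergence, and the monotone operator of the system. -/

section Spaces

variable {U : Set Plane}

lemma IsTestFunction.add {φ ψ : Plane → ℂ} (hφ : IsTestFunction U φ) (hψ : IsTestFunction U ψ) :
    IsTestFunction U (φ + ψ) :=
  ⟨hφ.1.add hψ.1, hφ.2.1.add hψ.2.1,
    (tsupport_add φ ψ).trans (union_subset hφ.2.2 hψ.2.2)⟩

lemma IsTestFunction.clm_comp {φ : Plane → ℂ} (hφ : IsTestFunction U φ) (L : ℂ →L[ℝ] ℂ) :
    IsTestFunction U (fun x => L (φ x)) := by
  refine ⟨L.contDiff.comp hφ.1, hφ.2.1.comp_left (map_zero L), subset_trans ?_ hφ.2.2⟩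
  exact closure_mono (Function.support_comp_subset (map_zero L) φ)

lemma IsTestFunction.differentiableAt {φ : Plane → ℂ} (hφ : IsTestFunction U φ) (x : Plane) :
    DifferentiableAt ℝ φ x :=
  hφ.1.differentiable (by simp) x

lemma partialDeriv_add {φ ψ : Plane → ℂ} (hφ : IsTestFunction U φ) (hψ : IsTestFunction U ψ)
    (i : Fin 2) (x : Plane) :
    partialDeriv i (φ + ψ) x = partialDeriv i φ x + partialDeriv i ψ x := by
  simp only [partialDeriv]
  rw [fderiv_add (hφ.differentiableAt x) (hψ.differentiableAt x)]
  rfl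

lemma partialDeriv_clm_comp {φ : Plane → ℂ} (hφ : IsTestFunction U φ) (L : ℂ →L[ℝ] ℂ)
    (i : Fin 2) (x : Plane) :
    partialDeriv i (fun x => L (φ x)) x = L (partialDeriv i φ x) := by
  have : HasFDerivAt (fun x => L (φ x)) (L.comp (fderiv ℝ φ x)) x :=
    L.hasFDerivAt.comp x (hφ.differentiableAt x).hasFDerivAt
  simp only [partialDeriv]
  rw [this.fderiv]
  rfl

/-- The gradient of a function as a `ℂ²`-valued function. -/
def gradVec (φ : Plane → ℂ) (x : Plane) : CVec := WithLp.toLp 2 fun i => partialDeriv i φ x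

lemma IsTestFunction.memLp {φ : Plane → ℂ} (hφ : IsTestFunction U φ) :
    MemLp φ 2 (volume.restrict U) :=
  (hφ.1.continuous.memLp_of_hasCompactSupport hφ.2.1).restrict U

lemma IsTestFunction.memLp_gradVec {φ : Plane → ℂ} (hφ : IsTestFunction U φ) :
    MemLp (gradVec φ) 2 (volume.restrict U) := by
  refine MemLp.restrict U (Continuous.memLp_of_hasCompactSupport ?_ ?_)
  · refine (PiLp.continuous_toLp 2 _).comp (continuous_pi fun i => ?_)
    exact (hφ.1.continuous_fderiv (by simp)).clm_apply continuous_const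
  · refine (hφ.2.1.fderiv ℝ).mono fun x hx => ?_
    contrapose! hx
    simp only [Function.mem_support, not_not] at hx ⊢
    ext i
    simp [gradVec, partialDeriv, hx]

lemma HasH10Gradient.add {v v' : L2 U} {g g' : L2Vec U} (h : HasH10Gradient U v g)
    (h' : HasH10Gradient U v' g') : HasH10Gradient U (v + v') (g + g') := by
  refine map_mem_closure₂ (f := fun a b : L2 U × L2Vec U => a + b) continuous_add h h' ?_
  rintro a ⟨φ, hφ, h1, h2⟩ b ⟨ψ, hψ, h3, h4⟩
  refine ⟨φ + ψ, hφ.add hψ, ?_, ?_⟩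
  · filter_upwards [h1, h3, Lp.coeFn_add a.1 b.1] with x e1 e2 e3
    rw [Prod.fst_add, e3, Pi.add_apply, e1, e2, Pi.add_apply]
  · filter_upwards [h2, h4, Lp.coeFn_add a.2 b.2] with x e1 e2 e3 i
    rw [Prod.snd_add, e3, Pi.add_apply, PiLp.add_apply, e1, e2, partialDeriv_add hφ hψ]

lemma HasH10Gradient.smul {v : L2 U} {g : L2Vec U} (c : ℝ) (h : HasH10Gradient U v g) :
    HasH10Gradient U (c • v) (c • g) := by
  refine map_mem_closure (f := fun a : L2 U × L2Vec U => c • a) (continuous_const_smul c) h ?_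
  rintro a ⟨φ, hφ, h1, h2⟩
  refine ⟨_, hφ.clm_comp (c • ContinuousLinearMap.id ℝ ℂ), ?_, ?_⟩
  · filter_upwards [h1, Lp.coeFn_smul c a.1] with x e1 e3
    rw [Prod.smul_fst, e3, Pi.smul_apply, e1]
    rfl
  · filter_upwards [h2, Lp.coeFn_smul c a.2] with x e1 e3 i
    rw [Prod.smul_snd, e3, Pi.smul_apply, PiLp.smul_apply, e1, partialDeriv_clm_comp hφ]
    rfl

lemma hasH10Gradient_zero : HasH10Gradient U 0 0 := by
  refine subset_closure ⟨0, ⟨contDiff_const, HasCompactSupport.zero, by simp⟩, ?_, ?_⟩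
  · filter_upwards [Lp.coeFn_zero ℂ 2 (volume.restrict U)] with x e
    rw [e]
  · filter_upwards [Lp.coeFn_zero CVec 2 (volume.restrict U)] with x e i
    rw [e]
    simp [partialDeriv]

lemma inner_toLp_test {φ : Plane → ℂ} (hφ : IsTestFunction U φ) (d : L2 U) :
    inner ℂ (hφ.memLp.toLp φ) d = ∫ x in U, d x * Complex.conjCLE (φ x) := by
  rw [L2.inner_def]
  refine integral_congr_ae ?_
  filter_upwards [hφ.memLp.coeFn_toLp] with x hx
  rw [hx]
  simp

lemma inner_toLp_gradVec {φ : Plane → ℂ} (hφ : IsTestFunction U φ) (q : L2Vec U) :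
    inner ℂ (hφ.memLp_gradVec.toLp (gradVec φ)) q
      = ∫ x in U, ∑ i, q x i * Complex.conjCLE (partialDeriv i φ x) := by
  rw [L2.inner_def]
  refine integral_congr_ae ?_
  filter_upwards [hφ.memLp_gradVec.coeFn_toLp] with x hx
  rw [hx, PiLp.inner_apply]
  simp [gradVec]

/-- Test functions are stable under conjugation, so the bilinear pairing may be replaced by the
Hermitian one. The condition becomes orthogonality to all pairs `(φ, ∇φ)`. -/
lemma hasWeakDiv_iff {q : L2Vec U} {d : L2 U} :
    HasWeakDiv U q d ↔ ∀ (φ : Plane → ℂ) (hφ : IsTestFunction U φ),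
      inner ℂ (hφ.memLp.toLp φ) d + inner ℂ (hφ.memLp_gradVec.toLp (gradVec φ)) q = 0 := by
  have key : ∀ (φ : Plane → ℂ) (hφ : IsTestFunction U φ),
      (inner ℂ (hφ.memLp.toLp φ) d + inner ℂ (hφ.memLp_gradVec.toLp (gradVec φ)) q = 0 ↔
      ∫ x in U, d x * (Complex.conjCLE (φ x))
        = - ∫ x in U, ∑ i, q x i * partialDeriv i (fun x => Complex.conjCLE (φ x)) x) := by
    intro φ hφ
    rw [inner_toLp_test hφ, inner_toLp_gradVec hφ, add_eq_zero_iff_eq_neg]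
    have := fun i x => partialDeriv_clm_comp hφ (Complex.conjCLE : ℂ →L[ℝ] ℂ) i x
    simp only [ContinuousLinearEquiv.coe_coe] at this
    simp_rw [this]
  constructor
  · intro h φ hφ
    exact (key φ hφ).2 (h _ (hφ.clm_comp (Complex.conjCLE : ℂ →L[ℝ] ℂ)))
  · intro h φ hφ
    have := (key _ (hφ.clm_comp (Complex.conjCLE : ℂ →L[ℝ] ℂ))).1
      (h _ (hφ.clm_comp (Complex.conjCLE : ℂ →L[ℝ] ℂ)))
    simpa using this

lemma HasWeakDiv.add {q q' : L2Vec U} {d d' : L2 U} (h : HasWeakDiv U q d)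
    (h' : HasWeakDiv U q' d') : HasWeakDiv U (q + q') (d + d') := by
  rw [hasWeakDiv_iff] at *
  intro φ hφ
  rw [inner_add_right, inner_add_right]
  linear_combination h φ hφ + h' φ hφ

lemma HasWeakDiv.smul {q : L2Vec U} {d : L2 U} (c : ℝ) (h : HasWeakDiv U q d) :
    HasWeakDiv U (c • q) (c • d) := by
  rw [hasWeakDiv_iff] at *
  intro φ hφ
  rw [inner_smul_right_eq_smul, inner_smul_right_eq_smul, ← smul_add, h φ hφ, smul_zero]

lemma hasWeakDiv_zero : HasWeakDiv U 0 0 := by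
  rw [hasWeakDiv_iff]
  intro φ hφ
  simp

/-- Both inner products induce the same norm, so polarization identifies them. -/
lemma real_inner_eq_re_inner_complex {H : Type*} [NormedAddCommGroup H] [InnerProductSpace ℝ H]
    [InnerProductSpace ℂ H] (x y : H) : inner ℝ x y = (inner ℂ x y).re := by
  rw [real_inner_eq_norm_add_mul_self_sub_norm_mul_self_sub_norm_mul_self_div_two]
  exact (re_inner_eq_norm_add_mul_self_sub_norm_mul_self_sub_norm_mul_self_div_two
    (𝕜 := ℂ) x y).symm

/-- Integration by parts between `H(div)` and `H¹₀`. -/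
lemma HasWeakDiv.inner_add_inner {q : L2Vec U} {d : L2 U} (h : HasWeakDiv U q d) {v : L2 U}
    {g : L2Vec U} (hv : HasH10Gradient U v g) : inner ℝ d v + inner ℝ g q = 0 := by
  have key : inner ℂ v d + inner ℂ g q = 0 := by
    -- The identity holds for test pairs by definition of the weak divergence, and it is a closed
    -- condition, so it passes to their closure.
    have hcl : IsClosed {w : L2 U × L2Vec U | inner ℂ w.1 d + inner ℂ w.2 q = 0} :=
      isClosed_eq (by fun_prop) continuous_const
    refine closure_minimal ?_ hcl hv
    rintro w ⟨φ, hφ, h1, h2⟩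
    have e1 : w.1 = hφ.memLp.toLp φ := by
      refine Lp.ext ?_
      filter_upwards [h1, hφ.memLp.coeFn_toLp] with x a b
      rw [a, b]
    have e2 : w.2 = hφ.memLp_gradVec.toLp (gradVec φ) := by
      refine Lp.ext ?_
      filter_upwards [h2, hφ.memLp_gradVec.coeFn_toLp] with x a b
      rw [b]
      ext i
      exact a i
    rw [mem_ofPred_eq, e1, e2]
    exact hasWeakDiv_iff.1 h φ hφ
  rw [real_inner_comm, real_inner_eq_re_inner_complex, real_inner_eq_re_inner_complex,
    ← Complex.add_re, key, Complex.zero_re]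

/-- The state space of the triples `(u, u*, p)`. -/
abbrev State (U : Set Plane) := WithLp 2 (L2 U × WithLp 2 (L2 U × L2Vec U))

/-- The graph of the operator `(u, u*, p) ↦ (2σu + σu* + div p, -σu, ∇u)`. -/
def pmlGraph (U : Set Plane) (σ : ℝ → ℝ) : Submodule ℝ (State U × State U) where
  carrier := {z | ∃ d : L2 U, HasH10Gradient U z.1.fst z.2.snd.snd ∧
    HasWeakDiv U z.1.snd.snd d ∧
    (∀ᵐ x ∂(volume.restrict U), z.2.fst x
      = ((2 * σ ‖x‖ : ℝ) : ℂ) * z.1.fst x + ((σ ‖x‖ : ℝ) : ℂ) * z.1.snd.fst x + d x) ∧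
    ∀ᵐ x ∂(volume.restrict U), z.2.snd.fst x = -(((σ ‖x‖ : ℝ) : ℂ) * z.1.fst x)}
  zero_mem' := by
    refine ⟨0, hasH10Gradient_zero, hasWeakDiv_zero, ?_, ?_⟩ <;>
    · filter_upwards [Lp.coeFn_zero ℂ 2 (volume.restrict U)] with x e
      simp only [Prod.fst_zero, Prod.snd_zero, WithLp.zero_fst, WithLp.zero_snd, e, Pi.zero_apply,
        mul_zero, add_zero, neg_zero]
  add_mem' := by
    rintro y z ⟨d, h1, h2, h3, h4⟩ ⟨d', h1', h2', h3', h4'⟩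
    refine ⟨d + d', h1.add h1', h2.add h2', ?_, ?_⟩
    · filter_upwards [h3, h3', Lp.coeFn_add y.2.fst z.2.fst, Lp.coeFn_add y.1.fst z.1.fst,
        Lp.coeFn_add y.1.snd.fst z.1.snd.fst, Lp.coeFn_add d d'] with x e1 e2 e3 e4 e5 e6
      simp only [Prod.fst_add, Prod.snd_add, WithLp.add_fst, WithLp.add_snd, e3, e4, e5, e6,
        Pi.add_apply, e1, e2]
      ring
    · filter_upwards [h4, h4', Lp.coeFn_add y.2.snd.fst z.2.snd.fst,
        Lp.coeFn_add y.1.fst z.1.fst] with x e1 e2 e3 e4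
      simp only [Prod.fst_add, Prod.snd_add, WithLp.add_fst, WithLp.add_snd, e3, e4,
        Pi.add_apply, e1, e2]
      ring
  smul_mem' := by
    rintro c z ⟨d, h1, h2, h3, h4⟩
    refine ⟨c • d, h1.smul c, h2.smul c, ?_, ?_⟩
    · filter_upwards [h3, Lp.coeFn_smul c z.2.fst, Lp.coeFn_smul c z.1.fst,
        Lp.coeFn_smul c z.1.snd.fst, Lp.coeFn_smul c d] with x e1 e3 e4 e5 e6
      simp only [Prod.smul_fst, Prod.smul_snd, WithLp.smul_fst, WithLp.smul_snd, e3, e4, e5, e6,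
        Pi.smul_apply, e1, Complex.real_smul]
      ring
    · filter_upwards [h4, Lp.coeFn_smul c z.2.snd.fst, Lp.coeFn_smul c z.1.fst] with x e1 e3 e4
      simp only [Prod.smul_fst, Prod.smul_snd, WithLp.smul_fst, WithLp.smul_snd, e3, e4,
        Pi.smul_apply, e1, Complex.real_smul]
      ring

/-- Skew-symmetry removes the `div`–`∇` pair and the `u`–`u*` coupling; what is left is `2∫ σ|u|²`.
Integrability comes from the `L²` elements `z.2.fst - d` and `z.2.snd.fst`, so no bound on `σ`
enters. -/
lemma inner_pmlGraph_nonneg {σ : ℝ → ℝ} (hσ : ∀ᵐ x ∂(volume.restrict U), 0 ≤ σ ‖x‖)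
    (z : State U × State U) (hz : z ∈ pmlGraph U σ) : 0 ≤ inner ℝ z.2 z.1 := by
  obtain ⟨d, h1, h2, h3, h4⟩ := hz
  have e : inner ℝ z.2 z.1 = inner ℝ (z.2.fst - d) z.1.fst + inner ℝ z.2.snd.fst z.1.snd.fst := by
    rw [WithLp.prod_inner_apply, WithLp.prod_inner_apply, inner_sub_left]
    have := h2.inner_add_inner h1
    change inner ℝ z.2.fst z.1.fst + (inner ℝ z.2.snd.fst z.1.snd.fst
      + inner ℝ z.2.snd.snd z.1.snd.snd) = _
    linarith
  rw [e, L2.inner_def, L2.inner_def, ← integral_add (L2.integrable_inner _ _)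
    (L2.integrable_inner _ _)]
  refine integral_nonneg_of_ae ?_
  filter_upwards [h3, h4, hσ, Lp.coeFn_sub z.2.fst d] with x e1 e2 hx e3
  rw [e3, Pi.sub_apply, e1, e2, add_sub_cancel_right]
  have : (0 : ℝ) ≤ 2 * σ ‖x‖ * ((z.1.fst x).re ^ 2 + (z.1.fst x).im ^ 2) := by positivity
  refine this.trans_eq ?_
  simp only [Complex.inner, Complex.mul_re, Complex.conj_re, Complex.conj_im, Complex.add_re,
    Complex.add_im, Complex.neg_re, Complex.neg_im, Complex.mul_im, Complex.ofReal_re,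
    Complex.ofReal_im]
  ring

end Spaces

/-! ### From the PML system to the monotone evolution equation. -/

section Solutions

variable {X : Type*} [NormedAddCommGroup X] {T : ℝ}

lemma MemL2Time.integrable_indicator {v : ℝ → X} (hv : MemL2Time T v) :
    Integrable ((Ioo 0 T).indicator v) :=
  (integrable_indicator_iff measurableSet_Ioo).2 (hv.integrable one_le_two)

lemma HasH1Deriv.primitive_indicator [NormedSpace ℝ X] {v v' : ℝ → X} (hv : HasH1Deriv T v v')
    (h0 : v 0 = 0) {t : ℝ} (ht : t ∈ Icc 0 T) :
    ∫ s in (0 : ℝ)..t, (Ioo 0 T).indicator v' s = v t := by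
  rw [hv.2 t ht, h0, zero_add]
  refine integral_congr_ae ?_
  have hne : ∀ᵐ s ∂(volume : Measure ℝ), s ≠ T := by simp [ae_iff]
  filter_upwards [hne] with s hs hst
  rw [uIoc_of_le ht.1] at hst
  have hsI : s ∈ Ioo 0 T := ⟨hst.1, lt_of_le_of_ne (hst.2.trans ht.2) hs⟩
  exact indicator_of_mem hsI _

lemma primitive_eq_zero [NormedSpace ℝ X] (c : ℝ → X) {s : ℝ} (hs : s ≤ 0)
    (hc : ∀ r ≤ 0, c r = 0) : ∫ r in (0 : ℝ)..s, c r = 0 := by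
  rw [integral_congr (g := fun _ => (0 : X))]
  · simp
  · intro r hr
    rw [uIcc_of_ge hs] at hr
    exact hc r hr.2

/-- Away from the origin `MᵀM = 1`. At the origin `polarMatrix` is zero, because division by zero
gives zero, so there the identity needs `s = 0`. -/
lemma sum_polarDiag_self (s : ℝ) (x : Plane) (hx : x = 0 → s = 0) (q : CVec) (i : Fin 2) :
    ∑ j, ((polarDiag s s x i j : ℝ) : ℂ) * q j = (s : ℂ) * q i := by
  have key : polarDiag s s x = s • (1 : Matrix (Fin 2) (Fin 2) ℝ) := by
    by_cases h : x = 0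
    · have : Matrix.diagonal ![s, s] = 0 := by
        ext i j
        fin_cases i <;> fin_cases j <;> simp [hx h]
      rw [polarDiag, this, hx h]
      simp
    · have hn : ‖x‖ ≠ 0 := norm_ne_zero_iff.2 h
      have h2 : x 0 ^ 2 + x 1 ^ 2 = ‖x‖ ^ 2 := by
        rw [EuclideanSpace.real_norm_sq_eq]; simp
      ext i j
      fin_cases i <;> fin_cases j <;>
        simp [polarDiag, polarMatrix, Matrix.mul_apply, Matrix.diagonal] <;> field_simp <;>
        first | linear_combination s * h2 | ring
  rw [key]
  fin_cases i <;> simp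

variable {U : Set Plane} {σ : ℝ → ℝ}

/-- For equal medium functions the fields `p` and `p*` coincide. -/
lemma eq_of_damped {p pS dp dpS : ℝ → L2Vec U} (hσ : ∀ᵐ x ∂(volume.restrict U), 0 ≤ σ ‖x‖)
    (hp : HasH1Deriv T p dp) (hpS : HasH1Deriv T pS dpS) (hp0 : p 0 = 0) (hpS0 : pS 0 = 0)
    (heq : ∀ᵐ t ∂(volume.restrict (Ioo 0 T)), ∀ᵐ x ∂(volume.restrict U), ∀ i,
      dp t x i + ((σ ‖x‖ : ℝ) : ℂ) * p t x i = dpS t x i + ((σ ‖x‖ : ℝ) : ℂ) * pS t x i)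
    {t : ℝ} (ht : t ∈ Icc 0 T) : p t = pS t := by
  have hi := hp.1.integrable_indicator
  have hiS := hpS.1.integrable_indicator
  have hprim : ∀ t ∈ Icc 0 T, ∫ s in (0 : ℝ)..t,
      ((Ioo 0 T).indicator dp s - (Ioo 0 T).indicator dpS s) = p t - pS t := by
    intro t ht
    rw [integral_sub hi.intervalIntegrable hiS.intervalIntegrable,
      hp.primitive_indicator hp0 ht, hpS.primitive_indicator hpS0 ht]
  -- The energy inequality with zero source: the difference of the fields is driven only by the
  -- monotone damping `σ`.
  have h := norm_primitive_le (G := fun _ => 0) (hi.sub hiS) (T := T) intervalIntegrable_const ?_ ht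
  · simp only [Pi.sub_apply, norm_zero, intervalIntegral.integral_zero, mul_zero] at h
    rw [hprim t ht] at h
    exact sub_eq_zero.1 (norm_le_zero_iff.1 h)
  · rw [ae_restrict_iff' measurableSet_Ioo] at heq
    filter_upwards [heq] with s hs h0 hT
    simp only [Pi.sub_apply]
    rw [hprim s ⟨h0.le, hT.le⟩, indicator_of_mem (show s ∈ Ioo 0 T from ⟨h0, hT⟩),
      indicator_of_mem (show s ∈ Ioo 0 T from ⟨h0, hT⟩), zero_sub, neg_sub, L2.inner_def]
    refine integral_nonneg_of_ae ?_
    filter_upwards [hs ⟨h0, hT⟩, hσ, Lp.coeFn_sub (p s) (pS s), Lp.coeFn_sub (dpS s) (dp s)]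
      with x e1 hx e2 e3
    have e4 : dpS s x - dp s x = σ ‖x‖ • (p s x - pS s x) := by
      ext i
      simp only [PiLp.sub_apply, PiLp.smul_apply, Complex.real_smul]
      linear_combination -(e1 i)
    rw [e2, e3, Pi.sub_apply, Pi.sub_apply, e4, real_inner_smul_left]
    exact mul_nonneg hx real_inner_self_nonneg

set_option maxHeartbeats 1000000 in
/-- The estimate for the transient truncated problem with a nonnegative absorption profile that
vanishes at the origin. -/
theorem IsPMLSolution.contDiffOn_and_bound (hσ : ∀ᵐ x ∂(volume.restrict U), 0 ≤ σ ‖x‖)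
    (hσ0 : σ 0 = 0) (hT : 0 < T) {f f' : ℝ → L2 U} (hf : HasH1Deriv T f f') (hf0 : f 0 = 0)
    {u uS : ℝ → L2 U} {p pS : ℝ → L2Vec U} (hsol : IsPMLSolution U σ σ T f u p uS pS) :
    ContDiffOn ℝ 1 u (Icc 0 T) ∧ ContDiffOn ℝ 1 p (Icc 0 T) ∧
    ContDiffOn ℝ 1 uS (Icc 0 T) ∧ ContDiffOn ℝ 1 pS (Icc 0 T) ∧
    ∀ t ∈ Icc 0 T,
      ‖derivWithin u (Icc 0 T) t‖ + ‖derivWithin p (Icc 0 T) t‖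
        + ‖derivWithin uS (Icc 0 T) t‖ + ‖derivWithin pS (Icc 0 T) t‖
      ≤ 8 * ∫ s in (0 : ℝ)..T, ‖f' s‖ := by
  obtain ⟨du, dp, duS, dpS, gradu, divp, hu, hp, huS, hpS, -, hgrad, -, hdiv, hu0, hp0, huS0, hpS0,
    heq⟩ := hsol
  have hdamp : ∀ᵐ t ∂(volume.restrict (Ioo 0 T)), ∀ᵐ x ∂(volume.restrict U), ∀ i,
      dp t x i + ((σ ‖x‖ : ℝ) : ℂ) * p t x i = dpS t x i + ((σ ‖x‖ : ℝ) : ℂ) * pS t x i := by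
    filter_upwards [heq] with t ht
    filter_upwards [ht] with x hx i
    have h0 : x = 0 → σ ‖x‖ = 0 := by rintro rfl; simpa using hσ0
    simpa only [sum_polarDiag_self _ x h0] using hx.2.2.2 i
  have hpp : ∀ t ∈ Icc 0 T, p t = pS t := fun t ht =>
    eq_of_damped hσ hp hpS hp0 hpS0 hdamp ht
  -- `a` and `b` are the time derivatives of `U` and `F`, extended by zero outside `(0,T)`. The zero
  -- initial values make the extended primitives solve the equation for negative times too.
  set a : ℝ → State U := fun s => WithLp.toLp 2 ((Ioo 0 T).indicator du s,
    WithLp.toLp 2 ((Ioo 0 T).indicator duS s, (Ioo 0 T).indicator dp s)) with ha_def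
  set b : ℝ → State U := fun s => WithLp.toLp 2 ((Ioo 0 T).indicator f' s, 0) with hb_def
  have ha : Integrable a :=
    (WithLp.prodContinuousLinearEquiv 2 ℝ _ _).symm.toContinuousLinearMap.integrable_comp
      (hu.1.integrable_indicator.prodMk
        ((WithLp.prodContinuousLinearEquiv 2 ℝ _ _).symm.toContinuousLinearMap.integrable_comp
          (huS.1.integrable_indicator.prodMk hp.1.integrable_indicator)))
  have hb : Integrable b :=
    (WithLp.prodContinuousLinearEquiv 2 ℝ _ _).symm.toContinuousLinearMap.integrable_comp
      (hf.1.integrable_indicator.prodMk (integrable_zero ℝ (WithLp 2 (L2 U × L2Vec U)) _))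
  set π₁ : State U →L[ℝ] L2 U := WithLp.fstL 2 ℝ _ _
  set π₂ : State U →L[ℝ] L2 U := (WithLp.fstL 2 ℝ _ _).comp (WithLp.sndL 2 ℝ _ _)
  set π₃ : State U →L[ℝ] L2Vec U := (WithLp.sndL 2 ℝ _ _).comp (WithLp.sndL 2 ℝ _ _)
  have ea₁ : ∀ t ∈ Icc 0 T, π₁ (∫ s in (0 : ℝ)..t, a s) = u t := fun t ht => by
    rw [← π₁.intervalIntegral_comp_comm ha.intervalIntegrable]
    exact hu.primitive_indicator hu0 ht
  have ea₂ : ∀ t ∈ Icc 0 T, π₂ (∫ s in (0 : ℝ)..t, a s) = uS t := fun t ht => by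
    rw [← π₂.intervalIntegral_comp_comm ha.intervalIntegrable]
    exact huS.primitive_indicator huS0 ht
  have ea₃ : ∀ t ∈ Icc 0 T, π₃ (∫ s in (0 : ℝ)..t, a s) = p t := fun t ht => by
    rw [← π₃.intervalIntegral_comp_comm ha.intervalIntegrable]
    exact hp.primitive_indicator hp0 ht
  have eb₁ : ∀ t ∈ Icc 0 T, π₁ (∫ s in (0 : ℝ)..t, b s) = f t := fun t ht => by
    rw [← π₁.intervalIntegral_comp_comm hb.intervalIntegrable]
    exact hf.primitive_indicator hf0 ht
  have eb₂ : ∀ t, π₂ (∫ s in (0 : ℝ)..t, b s) = 0 := fun t => by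
    rw [← π₂.intervalIntegral_comp_comm hb.intervalIntegrable]
    exact intervalIntegral.integral_zero
  have eb₃ : ∀ t, π₃ (∫ s in (0 : ℝ)..t, b s) = 0 := fun t => by
    rw [← π₃.intervalIntegral_comp_comm hb.intervalIntegrable]
    exact intervalIntegral.integral_zero
  have hneg : ∀ s ≤ 0, a s = 0 ∧ b s = 0 := fun s hs => by
    have : s ∉ Ioo 0 T := fun h => h.1.not_ge hs
    simp only [ha_def, hb_def, indicator_of_notMem this]
    exact ⟨rfl, rfl⟩
  have hgraph : ∀ᵐ s, s < T →
      ((∫ r in (0 : ℝ)..s, a r), (∫ r in (0 : ℝ)..s, b r) - a s) ∈ pmlGraph U σ := by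
    rw [ae_restrict_iff' measurableSet_Ioo] at hgrad hdiv heq hdamp
    filter_upwards [hgrad, hdiv, heq] with s h1 h2 h3 hsT
    rcases le_or_gt s 0 with hs | hs
    · rw [primitive_eq_zero a hs fun r hr => (hneg r hr).1, primitive_eq_zero b hs fun r hr => (hneg r hr).2, (hneg s hs).1, sub_zero]
      exact (pmlGraph U σ).zero_mem
    · have hI : s ∈ Ioo 0 T := ⟨hs, hsT⟩
      have hI' : s ∈ Icc 0 T := ⟨hs.le, hsT.le⟩
      have a₁ : (∫ r in (0 : ℝ)..s, a r).fst = u s := ea₁ s hI'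
      have a₂ : (∫ r in (0 : ℝ)..s, a r).snd.fst = uS s := ea₂ s hI'
      have a₃ : (∫ r in (0 : ℝ)..s, a r).snd.snd = p s := ea₃ s hI'
      have b₁ : ((∫ r in (0 : ℝ)..s, b r) - a s).fst = f s - du s := by
        rw [WithLp.sub_fst]
        exact congrArg₂ _ (eb₁ s hI') (indicator_of_mem hI du)
      have b₂ : ((∫ r in (0 : ℝ)..s, b r) - a s).snd.fst = -duS s := by
        rw [WithLp.sub_snd, WithLp.sub_fst, ← zero_sub]
        exact congrArg₂ _ (eb₂ s) (indicator_of_mem hI duS)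
      have b₃ : ((∫ r in (0 : ℝ)..s, b r) - a s).snd.snd = -dp s := by
        rw [WithLp.sub_snd, WithLp.sub_snd, ← zero_sub]
        exact congrArg₂ _ (eb₃ s) (indicator_of_mem hI dp)
      -- Since `p = p*`, the damping terms cancel and `∂ₜp = ∂ₜp* = -∇u`.
      have hg : -dp s = gradu s := by
        refine Lp.ext ?_
        filter_upwards [h3 hI, Lp.coeFn_neg (dp s)] with x hx e
        rw [e, Pi.neg_apply]
        ext i
        have h0 : x = 0 → σ ‖x‖ = 0 := by rintro rfl; simpa using hσ0
        have h4 := hx.2.2.2 i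
        rw [sum_polarDiag_self _ x h0, sum_polarDiag_self _ x h0, hpp s hI'] at h4
        rw [PiLp.neg_apply]
        linear_combination -h4 - hx.2.1 i
      refine ⟨divp s, ?_, ?_, ?_, ?_⟩
      · rw [a₁, b₃, hg]
        exact h1 hI
      · rw [a₃]
        exact h2 hI
      · rw [a₁, a₂, b₁]
        filter_upwards [h3 hI, Lp.coeFn_sub (f s) (du s)] with x hx e
        rw [e, Pi.sub_apply, ← hx.1]
        push_cast
        ring
      · rw [a₁, b₂]
        filter_upwards [h3 hI, Lp.coeFn_neg (duS s)] with x hx e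
        rw [e, Pi.neg_apply, hx.2.2.1]
  obtain ⟨w, hwc, hwa, hwb⟩ := exists_continuous_derivative (inner_pmlGraph_nonneg hσ) ha hb
    (fun s hs => (hneg s hs).1) hT hgraph
  have hbnorm : ∫ s, ‖b s‖ = ∫ s in (0 : ℝ)..T, ‖f' s‖ := by
    have : ∀ s, ‖b s‖ = (Ioo 0 T).indicator (fun s => ‖f' s‖) s := fun s => by
      rw [hb_def, WithLp.norm_toLp_fst, norm_indicator_eq_indicator_norm]
    simp_rw [this]
    rw [MeasureTheory.integral_indicator measurableSet_Ioo, integral_of_le hT.le,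
      integral_Ioc_eq_integral_Ioo]
  rw [hbnorm] at hwb
  have hproj : ∀ {Y : Type} [NormedAddCommGroup Y] [NormedSpace ℝ Y] [CompleteSpace Y]
      (π : State U →L[ℝ] Y) (v : ℝ → Y),
      (∀ t ∈ Icc 0 T, π (∫ s in (0 : ℝ)..t, a s) = v t) → ContDiffOn ℝ 1 v (Icc 0 T) ∧
        ∀ t ∈ Icc 0 T, derivWithin v (Icc 0 T) t = π (w t) := by
    intro Y _ _ _ π v hv
    refine contDiffOn_of_eq_primitive (π.continuous.comp hwc) hT fun t ht => ?_
    rw [← hv t ht, hwa t ht]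
    exact (π.intervalIntegral_comp_comm (hwc.intervalIntegrable _ _)).symm
  obtain ⟨cu, du_eq⟩ := hproj π₁ u ea₁
  obtain ⟨cuS, duS_eq⟩ := hproj π₂ uS ea₂
  obtain ⟨cp, dp_eq⟩ := hproj π₃ p ea₃
  obtain ⟨cpS, dpS_eq⟩ := hproj π₃ pS fun t ht => (ea₃ t ht).trans (hpp t ht)
  refine ⟨cu, cp, cuS, cpS, fun t ht => ?_⟩
  rw [du_eq t ht, duS_eq t ht, dp_eq t ht, dpS_eq t ht]
  -- Each of the four derivatives is a component of `w t`, that of `p*` being the one of `p`, and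
  -- `‖w t‖ ≤ 2∫ ‖f'‖`; this gives the factor 8.
  have n₁ : ‖π₁ (w t)‖ ≤ ‖w t‖ := WithLp.norm_fst_le _ (w t)
  have n₂ : ‖π₂ (w t)‖ ≤ ‖w t‖ := (WithLp.norm_fst_le _ (w t).snd).trans (WithLp.norm_snd_le _ (w t))
  have n₃ : ‖π₃ (w t)‖ ≤ ‖w t‖ := (WithLp.norm_snd_le _ (w t).snd).trans (WithLp.norm_snd_le _ (w t))
  have := hwb t ht
  linarith

lemma IsAbsorption.nonneg {R ρ : ℝ} (h : IsAbsorption R ρ σ) {r : ℝ} (hr : r ≤ ρ) : 0 ≤ σ r := by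
  rcases le_or_gt r R with hR | hR
  · exact (h.1 r hR).ge
  · exact (h.2.1 r ⟨hR, hr⟩).le

lemma Geometry.ae_norm_lt (G : Geometry) :
    ∀ᵐ x ∂(volume.restrict G.truncatedDomain), ‖x‖ < G.ρ := by
  rw [ae_restrict_iff (measurableSet_lt measurable_norm measurable_const)]
  exact Eventually.of_forall fun x hx => hx.1.2

/-- The absorption does not act on a source supported in the physical domain. -/
lemma IsSource.eLpNorm_add_mul {G : Geometry} {f f' : ℝ → L2 G.truncatedDomain}
    (hf : IsSource G T f f') (hσ : IsAbsorption G.R G.ρ σ) {s : ℝ} (hs : s ∈ Icc 0 T) :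
    (eLpNorm (fun x : Plane => f' s x + ((σ ‖x‖ : ℝ) : ℂ) * f s x) 2
      (volume.restrict G.truncatedDomain)).toReal = ‖f' s‖ := by
  obtain ⟨-, -, K, -, hK, hfK⟩ := hf
  rw [Lp.norm_def]
  congr 1
  refine eLpNorm_congr_ae ?_
  filter_upwards [hfK s hs] with x hx
  -- On `K` one has `‖x‖ < R`, where `σ` vanishes; off `K` the source vanishes.
  by_cases h : x ∈ K
  · simp [hσ.1 ‖x‖ (hK h).1.2.le]
  · simp [hx h]

end Solutions

end PML

end

theorem mainTheorem3 (G : PML.Geometry) :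
    ∃ C : ℝ, 0 < C ∧
      ∀ (σ : ℝ → ℝ), PML.IsAbsorption G.R G.ρ σ →
      ∀ (T : ℝ), 0 < T →
      ∀ (f f' : ℝ → PML.L2 G.truncatedDomain), PML.IsSource G T f f' →
      ∀ (u : ℝ → PML.L2 G.truncatedDomain) (p : ℝ → PML.L2Vec G.truncatedDomain)
        (uS : ℝ → PML.L2 G.truncatedDomain) (pS : ℝ → PML.L2Vec G.truncatedDomain),
        PML.IsPMLSolution G.truncatedDomain σ σ T f u p uS pS →
        ContDiffOn ℝ 1 u (Icc 0 T) ∧ ContDiffOn ℝ 1 p (Icc 0 T) ∧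
        ContDiffOn ℝ 1 uS (Icc 0 T) ∧ ContDiffOn ℝ 1 pS (Icc 0 T) ∧
        ∀ t ∈ Icc 0 T,
          ‖derivWithin u (Icc 0 T) t‖ + ‖derivWithin p (Icc 0 T) t‖
            + ‖derivWithin uS (Icc 0 T) t‖ + ‖derivWithin pS (Icc 0 T) t‖
          ≤ C * ∫ s in (0 : ℝ)..T,
              (eLpNorm (fun x : PML.Plane => f' s x + ((σ ‖x‖ : ℝ) : ℂ) * f s x) 2
                (volume.restrict G.truncatedDomain)).toReal := by
  refine ⟨8, by norm_num, fun σ hσ T hT f f' hf u p uS pS hsol => ?_⟩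
  have hnorm : ∫ s in (0 : ℝ)..T, (eLpNorm (fun x : PML.Plane =>
      f' s x + ((σ ‖x‖ : ℝ) : ℂ) * f s x) 2 (volume.restrict G.truncatedDomain)).toReal
      = ∫ s in (0 : ℝ)..T, ‖f' s‖ := by
    refine intervalIntegral.integral_congr fun s hs => ?_
    rw [uIcc_of_le hT.le] at hs
    exact hf.eLpNorm_add_mul hσ hs
  rw [hnorm]
  refine hsol.contDiffOn_and_bound ?_ (hσ.1 0 G.R_pos.le) hT hf.1 hf.2.1
  filter_upwards [G.ae_norm_lt] with x hx
  exact hσ.nonneg hx.le
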